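/- Let $T$ be a tree (a connected acyclic simple graph with at least one vertex, finite or infinite, of arbitrary cardinality) with vertex set $V(T)$, and write $|T|$ for the cardinality of $V(T)$. Let $\Delta(T)$ be the supremum of the degrees of the vertices of $T$, taken in the cardinals. Let the motion $m(T)$ be the minimum cardinality of $\{v\in V(T):\varphi(v)\ne v\}$ over all non-identity automorphisms $\varphi$ of $T$; if the identity is the only automorphism of $T$, then by convention $m(T)$ is greater than every cardinal, so that it is infinite and the bound $\Delta(T)\le 2^{m(T)}$ holds. A set $S\subseteq V(T)$ is distinguishing if the identity is the only automorphism $\varphi$ of $T$ with $\varphi(S)=S$. Two distinguishing sets $S,S'$ are equivalent if $\varphi(S)=S'$ for some automorphism $\varphi$ of $T$, and $a(T)$ is the cardinal number of equivalence classes of distinguishing sets. The tree $T$ is rayless if it contains no one-sided infinite path, and one-ended if it contains a one-sided infinite path but no two-sided infinite path. Theorem. If $T$ is rayless or one-ended, its motion $m=m(T)$ is infinite, and $\Delta(T)\le 2^{m}$, then $a(T)=2^{|T|}$. -/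

import Mathlib

universe u

namespace TreeAsym

open Cardinal

variable {V : Type u}

/-- A ray: a one-sided infinite path `r 0, r 1, r 2, …`. -/
def IsRay (G : SimpleGraph V) (r : ℕ → V) : Prop :=
  Function.Injective r ∧ ∀ n, G.Adj (r n) (r (n + 1))

/-- A double ray: a two-sided infinite path `…, r (-1), r 0, r 1, …`. -/
def IsDoubleRay (G : SimpleGraph V) (r : ℤ → V) : Prop :=
  Function.Injective r ∧ ∀ n, G.Adj (r n) (r (n + 1))

def Rayless (G : SimpleGraph V) : Prop :=
  ¬ ∃ r : ℕ → V, IsRay G r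

/-- A one-ended graph contains rays but no double rays. -/
def OneEnded (G : SimpleGraph V) : Prop :=
  (∃ r : ℕ → V, IsRay G r) ∧ ¬ ∃ r : ℤ → V, IsDoubleRay G r

/-- `Δ(G)`: the supremum of the degrees of the vertices, as a cardinal. -/
noncomputable def maxDegree (G : SimpleGraph V) : Cardinal.{u} :=
  ⨆ v : V, #(G.neighborSet v)

/-- `m(G)`: the minimum number of vertices moved by a non-identity automorphism of `G`.
For an asymmetric graph the infimum is over the empty family and equals `⊤`, which is
greater than every cardinal. -/
noncomputable def motion (G : SimpleGraph V) : WithTop Cardinal.{u} :=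
  ⨅ φ : {φ : G ≃g G // φ ≠ SimpleGraph.Iso.refl},
    ((#{v : V | φ.1 v ≠ v} : Cardinal.{u}) : WithTop Cardinal.{u})

/-- `S` is distinguishing: only the identity automorphism fixes `S` setwise. -/
def IsDistinguishing (G : SimpleGraph V) (S : Set V) : Prop :=
  ∀ φ : G ≃g G, φ '' S = S → φ = SimpleGraph.Iso.refl

/-- Equivalence of distinguishing sets: some automorphism maps one onto the other. -/
def distinguishingSetoid (G : SimpleGraph V) : Setoid {S : Set V // IsDistinguishing G S} where
  r S S' := ∃ φ : G ≃g G, φ '' S.1 = S'.1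
  iseqv :=
    { refl := fun S => ⟨SimpleGraph.Iso.refl, by simp⟩
      symm := by
        rintro S S' ⟨φ, h⟩
        refine ⟨φ.symm, ?_⟩
        rw [← h, Set.image_image]
        simp
      trans := by
        rintro S S' S'' ⟨φ, h⟩ ⟨ψ, h'⟩
        refine ⟨φ.trans ψ, ?_⟩
        rw [← h', ← h, Set.image_image]
        rfl }

/-- `a(G)`: the asymmetrizing number, i.e. the number of equivalence classes of
distinguishing sets. -/
noncomputable def asymNumber (G : SimpleGraph V) : Cardinal.{u} :=
  #(Quotient (distinguishingSetoid G))

end TreeAsym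

/-!
The upper bound on the number of classes is trivial, and if the identity is the only automorphism
all sets are distinguishing and pairwise inequivalent. Otherwise the motion is an infinite cardinal
`m`, and one has to find `2 ^ #V` pairwise inequivalent distinguishing sets.

Orient the tree canonically by a parent map that commutes with all automorphisms (`IsParentMap`).
In a one-ended tree the parent of `v` is the second vertex of a ray starting at `v`; it does not
depend on the ray because two rays leaving `v` by different edges would form a double ray. In a rayless tree parents lie in the direction of a centre, which consists of one vertex or
of two adjacent vertices: looking into the tree along its edges is a well-founded relation, and its
ordinal rank is a strictly quasiconvex eccentricity (`eccentricity_lt_max`). In both cases there is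
no infinite sequence of successive children, so one can argue by induction from the branches at
the children of a vertex to the branch at the vertex itself.

The claim of this induction is that the subsets of a branch can be injectively turned into
distinguishing sets of the branch, inequivalent under the stabilizer of its top
(`exists_isChildrenCode`). If siblings `w` and `w'` are in one orbit, exchanging their branches is
an automorphism that moves nothing else (`IsParentMap.exists_swap`), so each of these branches
has at least `m` vertices. By induction it has at least `2 ^ m ≥ Δ` inequivalent colourings, which
is enough to give the siblings of an orbit disjoint families of colourings of full size.

Finally, these colourings are put on the branches growing out of a trunk which all automorphisms
respecting the colours fix pointwise (`IsParentMap.exists_code_of_trunk`). The trunk is the centre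
of a rayless tree, and a ray in a one-ended tree. In the second case every automorphism fixes a
tail of the ray, since a translation would contradict well-foundedness
(`IsParentMap.map_ne_iterate`). It fixes the rest of the ray too: siblings isomorphic to a vertex
of the ray are coloured and the ray is not.
-/

namespace TreeAsym

open Cardinal

variable {V : Type u} {T : SimpleGraph V} {p : V → V} {m : Cardinal.{u}}

/-! ### Equivariant parent maps and their branches -/

/-- A parent map on a graph whose edges, apart from those joining two roots (fixed points of `p`),
are exactly the pairs `{v, p v}`. It commutes with all automorphisms, and there is no infinite
sequence in which every vertex is a child of the one before. There may be several roots, or none. -/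
structure IsParentMap (T : SimpleGraph V) (p : V → V) : Prop where
  adj_parent : ∀ v, p v ≠ v → T.Adj v (p v)
  of_adj : ∀ u v, T.Adj u v → p u = v ∨ p v = u ∨ (p u = u ∧ p v = v)
  map_parent : ∀ (φ : T ≃g T) v, φ (p v) = p (φ v)
  wf : WellFounded fun w v => p w = v ∧ w ≠ v

/-- The branch at `v`: the vertex `v` and all its descendants. -/
def branch (p : V → V) (v : V) : Set V := {x | ∃ n, p^[n] x = v}

lemma self_mem_branch (v : V) : v ∈ branch p v := ⟨0, rfl⟩

lemma mem_branch_parent (v : V) : v ∈ branch p (p v) := ⟨1, rfl⟩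

lemma mem_branch_of_parent_mem {x v : V} (h : p x ∈ branch p v) : x ∈ branch p v := by
  obtain ⟨n, hn⟩ := h
  exact ⟨n + 1, hn⟩

lemma parent_mem_branch {x v : V} (h : x ∈ branch p v) (hne : x ≠ v) : p x ∈ branch p v := by
  obtain ⟨n, hn⟩ := h
  cases n with
  | zero => exact absurd hn hne
  | succ n => exact ⟨n, hn⟩

lemma branch_trans {x y z : V} (hx : x ∈ branch p y) (hy : y ∈ branch p z) : x ∈ branch p z := by
  obtain ⟨n, rfl⟩ := hx
  obtain ⟨k, rfl⟩ := hy
  exact ⟨k + n, Function.iterate_add_apply p k n x⟩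

lemma branch_total {x a b : V} (ha : x ∈ branch p a) (hb : x ∈ branch p b) :
    a ∈ branch p b ∨ b ∈ branch p a := by
  obtain ⟨n, rfl⟩ := ha
  obtain ⟨k, rfl⟩ := hb
  rcases le_total n k with h | h
  · exact .inl ⟨k - n, by rw [← Function.iterate_add_apply, Nat.sub_add_cancel h]⟩
  · exact .inr ⟨n - k, by rw [← Function.iterate_add_apply, Nat.sub_add_cancel h]⟩

/-- The last vertex before entering `R`, on the way from `x` towards its ancestors. -/
lemma exists_mem_branch_of_iterate_mem {R : Set V} {x : V} {n : ℕ} (hn : p^[n] x ∈ R)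
    (hx : x ∉ R) : ∃ w, w ∉ R ∧ p w ∈ R ∧ x ∈ branch p w := by
  induction n generalizing x with
  | zero => exact absurd hn hx
  | succ n ih =>
    by_cases h : p x ∈ R
    · exact ⟨x, hx, h, self_mem_branch x⟩
    · obtain ⟨w, h1, h2, h3⟩ := ih hn h
      exact ⟨w, h1, h2, mem_branch_of_parent_mem h3⟩

namespace IsParentMap

lemma eq_of_iterate_eq (h : IsParentMap T p) (n : ℕ) (w : V) : p^[n + 1] w = w → p w = w := by
  induction w using h.wf.induction with
  | _ w ih =>
    intro hw
    have hz : p (p^[n] w) = w := (Function.iterate_succ_apply' p n w).symm.trans hw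
    by_cases hne : p^[n] w = w
    · rwa [hne] at hz
    · have := ih _ ⟨hz, hne⟩ (by rw [Function.iterate_succ_apply, hz])
      exact absurd (this.symm.trans hz) hne

lemma branch_antisymm (h : IsParentMap T p) {a b : V} (hab : a ∈ branch p b)
    (hba : b ∈ branch p a) : a = b := by
  obtain ⟨n, rfl⟩ := hab
  obtain ⟨k, hk⟩ := hba
  rcases n with _ | n
  · rfl
  · rw [← Function.iterate_add_apply, ← add_assoc] at hk
    exact (Function.iterate_fixed (h.eq_of_iterate_eq _ _ hk) _).symm

lemma parent_notMem_branch (h : IsParentMap T p) {w : V} (hw : p w ≠ w) :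
    p w ∉ branch p w :=
  fun hmem => hw (h.branch_antisymm hmem (mem_branch_parent w))

lemma map_iterate (h : IsParentMap T p) (φ : T ≃g T) (n : ℕ) (v : V) :
    φ (p^[n] v) = p^[n] (φ v) :=
  Function.Semiconj.iterate_right (f := φ) (h.map_parent φ) n v

lemma map_mem_branch (h : IsParentMap T p) (φ : T ≃g T) {x v : V} :
    φ x ∈ branch p (φ v) ↔ x ∈ branch p v := by
  simp only [branch, Set.mem_ofPred_eq, ← h.map_iterate, φ.injective.eq_iff]

lemma symm_mem_branch (h : IsParentMap T p) (φ : T ≃g T) {x v : V} :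
    φ.symm x ∈ branch p v ↔ x ∈ branch p (φ v) := by
  rw [← h.map_mem_branch φ, RelIso.apply_symm_apply]

lemma branch_map (h : IsParentMap T p) (φ : T ≃g T) (v : V) :
    branch p (φ v) = φ '' branch p v := by
  ext x
  constructor
  · intro hx
    exact ⟨φ.symm x, (h.symm_mem_branch φ).2 hx, by simp⟩
  · rintro ⟨y, hy, rfl⟩
    exact (h.map_mem_branch φ).2 hy

lemma map_parent_ne (h : IsParentMap T p) (φ : T ≃g T) {w : V} (hw : p w ≠ w) :
    p (φ w) ≠ φ w := by
  rw [← h.map_parent]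
  exact fun e => hw (φ.injective e)

/-- Branches at distinct siblings are disjoint. -/
lemma eq_of_mem_branch_of_mem_branch (h : IsParentMap T p) {w w' x : V} (hw : p w ≠ w)
    (hw' : p w' ≠ w') (hp : p w' = p w) (hx : x ∈ branch p w) (hx' : x ∈ branch p w') :
    w = w' := by
  by_contra hne
  rcases branch_total hx hx' with h1 | h1
  · exact h.parent_notMem_branch hw' (hp ▸ parent_mem_branch h1 hne)
  · exact h.parent_notMem_branch hw (hp ▸ parent_mem_branch h1 (Ne.symm hne))

/-- If an automorphism maps `w` to a sibling of `w`, then some automorphism exchanges the branches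
at these two vertices and fixes all other vertices. -/
lemma exists_swap (h : IsParentMap T p) {w : V} (φ : T ≃g T) (hw : p w ≠ w)
    (hp : p (φ w) = p w) (hne : φ w ≠ w) :
    ∃ ψ : T ≃g T, ψ w = φ w ∧ ∀ x, ψ x ≠ x → x ∈ branch p w ∨ x ∈ branch p (φ w) := by
  classical
  have hw' := h.map_parent_ne φ hw
  have hdisj : ∀ x, x ∈ branch p w → x ∉ branch p (φ w) := fun x hx hx' =>
    hne (h.eq_of_mem_branch_of_mem_branch hw hw' hp hx hx').symm
  let f : V → V := fun x =>
    if x ∈ branch p w then φ x else if x ∈ branch p (φ w) then φ.symm x else x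
  have f1 : ∀ x, x ∈ branch p w → f x = φ x := fun x hx => if_pos hx
  have f2 : ∀ x, x ∈ branch p (φ w) → f x = φ.symm x := fun x hx => by
    simp only [f]
    rw [if_neg fun hx' => hdisj x hx' hx, if_pos hx]
  have f3 : ∀ x, x ∉ branch p w → x ∉ branch p (φ w) → f x = x := fun x hx hx' => by
    simp only [f]
    rw [if_neg hx, if_neg hx']
  have hinv : Function.Involutive f := fun x => by
    by_cases hx : x ∈ branch p w
    · rw [f1 x hx, f2 _ ((h.map_mem_branch φ).2 hx), RelIso.symm_apply_apply]
    by_cases hx' : x ∈ branch p (φ w)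
    · rw [f2 x hx', f1 _ ((h.symm_mem_branch φ).2 hx'), RelIso.apply_symm_apply]
    · rw [f3 x hx hx', f3 x hx hx']
  have hv : p w ∉ branch p w := h.parent_notMem_branch hw
  have hv' : p w ∉ branch p (φ w) := by
    rw [← hp]
    exact h.parent_notMem_branch hw'
  have hpar : ∀ x, p x ≠ x → T.Adj (f x) (f (p x)) := fun x hpx => by
    have hadj := h.adj_parent x hpx
    by_cases hx : x ∈ branch p w
    · by_cases hxw : x = w
      · subst hxw
        rw [f1 x hx, f3 _ hv hv', ← hp]
        exact h.adj_parent _ hw'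
      · rw [f1 x hx, f1 _ (parent_mem_branch hx hxw)]
        exact φ.map_rel_iff.2 hadj
    by_cases hx' : x ∈ branch p (φ w)
    · by_cases hxw : x = φ w
      · rw [f2 x hx', hxw, hp, f3 _ hv hv', RelIso.symm_apply_apply]
        exact h.adj_parent w hw
      · rw [f2 x hx', f2 _ (parent_mem_branch hx' hxw)]
        exact φ.symm.map_rel_iff.2 hadj
    · rw [f3 x hx hx', f3 _ (fun k => hx (mem_branch_of_parent_mem k))
        (fun k => hx' (mem_branch_of_parent_mem k))]
      exact hadj
  have hroot : ∀ x, p x = x → f x = x := fun x hpx => by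
    have hfix : ∀ n, p^[n] x = x := fun n => Function.iterate_fixed hpx n
    refine f3 x ?_ ?_
    · rintro ⟨n, hn⟩
      rw [hfix] at hn
      exact hw (hn ▸ hpx)
    · rintro ⟨n, hn⟩
      rw [hfix] at hn
      exact hw' (hn ▸ hpx)
  have hadj : ∀ x y, T.Adj x y → T.Adj (f x) (f y) := fun x y hxy => by
    rcases h.of_adj x y hxy with e | e | ⟨e, e'⟩
    · subst e
      exact hpar x hxy.ne'
    · subst e
      exact (hpar y hxy.ne).symm
    · rwa [hroot x e, hroot y e']
  refine ⟨⟨hinv.toPerm f, fun {a b} => ⟨fun k => ?_, hadj a b⟩⟩, f1 w (self_mem_branch w), ?_⟩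
  · have := hadj _ _ k
    simpa [hinv a, hinv b] using this
  · intro x hx
    by_contra! hcon
    exact hx (f3 x hcon.1 hcon.2)

lemma mk_branch_map (h : IsParentMap T p) (φ : T ≃g T) (w : V) :
    #(branch p (φ w)) = #(branch p w) := by
  rw [h.branch_map φ w]
  exact mk_image_eq φ.injective

/-- A branch with an isomorphic sibling is at least as large as the motion. -/
lemma le_mk_branch (h : IsParentMap T p) (hm0 : ℵ₀ ≤ m)
    (hm : ∀ φ : T ≃g T, φ ≠ SimpleGraph.Iso.refl → m ≤ #{v : V | φ v ≠ v})
    {w : V} (φ : T ≃g T) (hw : p w ≠ w) (hp : p (φ w) = p w) (hne : φ w ≠ w) :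
    m ≤ #(branch p w) := by
  obtain ⟨ψ, h1, h2⟩ := h.exists_swap φ hw hp hne
  have hψ : ψ ≠ SimpleGraph.Iso.refl := by
    rintro rfl
    exact hne h1.symm
  have hle : m ≤ #(branch p w) + #(branch p w) := calc
    m ≤ #{v : V | ψ v ≠ v} := hm ψ hψ
    _ ≤ #(branch p w ∪ branch p (φ w) : Set V) := mk_le_mk_of_subset fun x hx => h2 x hx
    _ ≤ #(branch p w) + #(branch p (φ w)) := mk_union_le _ _
    _ = #(branch p w) + #(branch p w) := by rw [h.mk_branch_map]
  have hinf : ℵ₀ ≤ #(branch p w) := by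
    by_contra! hlt
    exact absurd (hm0.trans hle) (not_le.2 (add_lt_aleph0 hlt hlt))
  rwa [add_eq_self hinf] at hle

end IsParentMap

/-! ### Inequivalent distinguishing sets of the branches -/

/-- `F` encodes subsets of the branch at `v` (only `X ∩ branch p v` matters in `F X`) by
distinguishing sets of the branch such that different codes are inequivalent under the stabilizer
of `v`; the colour of `v` itself is not changed. -/
def IsBranchCode (T : SimpleGraph V) (p : V → V) (v : V) (F : Set V → Set V) : Prop :=
  (∀ X, v ∈ F X ↔ v ∈ X) ∧
    ∀ (φ : T ≃g T) (X Y : Set V), φ v = v → (∀ x ∈ branch p v, x ∈ F X ↔ φ x ∈ F Y) →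
      ∀ x ∈ branch p v, (x ∈ X ↔ x ∈ Y) ∧ φ x = x

/-- Codes `J w` of the subsets of the branches at all children `w` of `v`, such that different
codes are inequivalent even when they belong to different children. A child that can be mapped to
one of its siblings belongs to all of its codes. -/
def IsChildrenCode (T : SimpleGraph V) (p : V → V) (v : V) (J : V → Set V → Set V) : Prop :=
  (∀ w, p w = v → w ≠ v → ∀ φ : T ≃g T, p (φ w) = v → φ w ≠ w → ∀ X, w ∈ J w X) ∧
    ∀ w, p w = v → w ≠ v → ∀ (φ : T ≃g T) (X Y : Set V), p (φ w) = v →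
      (∀ x ∈ branch p w, x ∈ J w X ↔ φ x ∈ J (φ w) Y) →
        φ w = w ∧ ∀ x ∈ branch p w, (x ∈ X ↔ x ∈ Y) ∧ φ x = x

/-- The subsets of an infinite set `B` can be encoded, injectively, by subsets containing a given
element, in any number up to `2 ^ #B` of ways whose ranges are disjoint. -/
lemma exists_disjoint_encodings {B : Set V} {c : V} (hc : c ∈ B) (hB : ℵ₀ ≤ #B) {K : Type u}
    (hK : #K ≤ 2 ^ #B) :
    ∃ E : K → Set V → Set V, (∀ k X, c ∈ E k X) ∧
      ∀ k k' X Y, (∀ x ∈ B, x ∈ E k X ↔ x ∈ E k' Y) → k = k' ∧ ∀ x ∈ B, x ∈ X ↔ x ∈ Y := by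
  have : Infinite B := infinite_iff.2 hB
  have hcompl : #(({⟨c, hc⟩}ᶜ : Set B)) = #B :=
    mk_compl_of_infinite _ (by rw [mk_singleton]; exact one_lt_aleph0.trans_le hB)
  have hle : #(K × Set B) ≤ #(Set ({⟨c, hc⟩}ᶜ : Set B)) := by
    rw [mk_set, hcompl, mk_prod, lift_id, lift_id, mk_set]
    exact mul_le_of_le (hB.trans (cantor _).le) hK le_rfl
  obtain ⟨e⟩ := hle
  refine ⟨fun k X => {x | x = c ∨ ∃ b ∈ e (k, {b | (b : V) ∈ X}), ((b : B) : V) = x},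
    fun k X => .inl rfl, fun k k' X Y hXY => ?_⟩
  have key : e (k, {b | (b : V) ∈ X}) = e (k', {b | (b : V) ∈ Y}) := by
    ext b
    have hbc : ((b : B) : V) ≠ c := fun hb => b.2 (Subtype.ext hb)
    have hb := hXY _ b.1.2
    simpa [hbc, Subtype.ext_iff] using hb
  have := e.injective key
  simp only [Prod.mk.injEq] at this
  refine ⟨this.1, fun x hx => ?_⟩
  exact Set.ext_iff.1 this.2 ⟨x, hx⟩

namespace IsParentMap

/-- An automorphism that fixes `v` and respects the colours permutes the children of `v` together
with the codes used at them. -/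
lemma exists_isBranchCode_of_isChildrenCode (h : IsParentMap T p) {v : V}
    {J : V → Set V → Set V} (hJ : IsChildrenCode T p v J) : ∃ F, IsBranchCode T p v F := by
  let F : Set V → Set V := fun X =>
    {x | (x = v ∧ v ∈ X) ∨ ∃ w, (p w = v ∧ w ≠ v) ∧ x ∈ branch p w ∧ x ∈ J w X}
  have hnot : ∀ w, p w = v → w ≠ v → v ∉ branch p w := fun w hw hwv => by
    subst hw
    exact h.parent_notMem_branch hwv.symm
  have hroot : ∀ X, v ∈ F X ↔ v ∈ X := fun X => by
    constructor
    · rintro (hx | ⟨w, ⟨hw, hwv⟩, hx, -⟩)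
      · exact hx.2
      · exact absurd hx (hnot w hw hwv)
    · exact fun hx => .inl ⟨rfl, hx⟩
  have hF : ∀ w, p w = v → w ≠ v → ∀ x ∈ branch p w, ∀ X, x ∈ F X ↔ x ∈ J w X := by
    intro w hw hwv x hx X
    constructor
    · rintro (⟨rfl, -⟩ | ⟨w', ⟨hw', hwv'⟩, hx', hxJ⟩)
      · exact absurd hx (hnot w hw hwv)
      · rwa [h.eq_of_mem_branch_of_mem_branch (hw.trans_ne hwv.symm) (hw'.trans_ne hwv'.symm)
          (hw'.trans hw.symm) hx hx']
    · exact fun hxJ => .inr ⟨w, ⟨hw, hwv⟩, hx, hxJ⟩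
  refine ⟨F, hroot, fun φ X Y hφ hXY x hx => ?_⟩
  by_cases hxv : x = v
  · subst hxv
    have := hXY x hx
    rw [hφ, hroot, hroot] at this
    exact ⟨this, hφ⟩
  · obtain ⟨n, hn⟩ := hx
    obtain ⟨w, hwv, hw, hxw⟩ := exists_mem_branch_of_iterate_mem (R := {v}) hn hxv
    have hpφ : p (φ w) = v := by rw [← h.map_parent, hw, hφ]
    have hφw : φ w ≠ v := fun e => hwv (φ.injective (e.trans hφ.symm))
    refine (hJ.2 w hw hwv φ X Y hpφ fun y hy => ?_).2 x hxw
    rw [← hF w hw hwv y hy, ← hF (φ w) hpφ hφw _ ((h.map_mem_branch φ).2 hy)]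
    exact hXY y (branch_trans hy (hw ▸ mem_branch_parent w))

/-- The branches at children in different orbits are inequivalent whatever their colours. An orbit
with two or more children consists of branches with at least `m` vertices, hence with `2 ^ m` or
more inequivalent colourings, which suffices to serve all children with disjoint families. -/
lemma exists_isChildrenCode_of_forall_isBranchCode (h : IsParentMap T p) (hm0 : ℵ₀ ≤ m)
    (hm : ∀ φ : T ≃g T, φ ≠ SimpleGraph.Iso.refl → m ≤ #{v : V | φ v ≠ v})
    (hd : ∀ v, #(T.neighborSet v) ≤ 2 ^ m) {v : V}
    (hF : ∀ w, p w = v → w ≠ v → ∃ F, IsBranchCode T p w F) :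
    ∃ J, IsChildrenCode T p v J := by
  let C : Type u := {w : V // p w = v ∧ w ≠ v}
  -- a representative `rep w` of each orbit of children, and `ψ w` mapping it to `w`
  let s : Setoid C :=
    { r := fun a b => ∃ φ : T ≃g T, φ a = b
      iseqv :=
        { refl := fun a => ⟨SimpleGraph.Iso.refl, rfl⟩
          symm := by
            rintro a b ⟨φ, hφ⟩
            exact ⟨φ.symm, by rw [← hφ, RelIso.symm_apply_apply]⟩
          trans := by
            rintro a b c ⟨φ, hφ⟩ ⟨ψ, hψ⟩
            exact ⟨φ.trans ψ, by rw [← hψ, ← hφ]; rfl⟩ } }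
  let rep : C → C := fun w => (Quotient.mk s w).out
  have hrep : ∀ w, ∃ φ : T ≃g T, φ (rep w) = w := fun w =>
    Quotient.exact (s := s) (Quotient.out_eq (Quotient.mk s w))
  have hrep_eq : ∀ (w w' : C) (φ : T ≃g T), φ w = w' → rep w = rep w' := fun w w' φ hφ =>
    congrArg Quotient.out (Quotient.sound (s := s) ⟨φ, hφ⟩)
  choose ψ hψ using hrep
  have hCle : #C ≤ 2 ^ m := by
    refine le_trans (mk_le_of_injective (f := fun w : C => (⟨w, ?_⟩ : T.neighborSet v)) ?_) (hd v)
    · have := h.adj_parent w.1 (by rw [w.2.1]; exact w.2.2.symm)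
      rw [w.2.1] at this
      exact this.symm
    · intro a b hab
      exact Subtype.ext (congrArg (fun z : T.neighborSet v => (z : V)) hab)
  -- within one orbit, the colourings of the branch at the representative are shared out among
  -- the children in such a way that no two of them get equivalent colourings
  have hE : ∀ c : C, ∃ E : C → Set V → Set V,
      (∀ w, rep w = c → (∃ φ : T ≃g T, p (φ w) = v ∧ φ w ≠ w) → ∀ X, (c : V) ∈ E w X) ∧
      ∀ w w', rep w = c → rep w' = c → ∀ X Y,
        (∀ x ∈ branch p (c : V), x ∈ E w X ↔ x ∈ E w' Y) →
          w = w' ∧ ∀ x ∈ branch p (c : V), x ∈ X ↔ x ∈ Y := by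
    intro c
    by_cases hc : ∃ w, rep w = c ∧ w ≠ c
    · obtain ⟨w, rfl, hwc⟩ := hc
      have hmle : m ≤ #(branch p (rep w : V)) := by
        refine h.le_mk_branch hm0 hm (ψ w) ?_ ?_ ?_
        · rw [(rep w).2.1]; exact (rep w).2.2.symm
        · rw [hψ, w.2.1, (rep w).2.1]
        · rw [hψ]; exact fun e => hwc (Subtype.ext e)
      obtain ⟨E, h1, h2⟩ := exists_disjoint_encodings (K := C) (self_mem_branch (rep w : V))
        (hm0.trans hmle) (hCle.trans (power_le_power_left two_ne_zero hmle))
      exact ⟨E, fun w _ _ X => h1 w X, fun w w' _ _ X Y hXY => h2 w w' X Y hXY⟩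
    · push Not at hc
      refine ⟨fun _ X => X, ?_, ?_⟩
      · rintro w hw ⟨φ, hφ, hne⟩
        have hφ' : φ w ≠ v := fun e => by
          have := h.map_parent_ne φ (w := w) (by rw [w.2.1]; exact w.2.2.symm)
          rw [hφ] at this
          exact this e.symm
        have e2 := hc ⟨φ w, hφ, hφ'⟩ ((hrep_eq w _ φ rfl).symm.trans hw)
        exact absurd (congrArg Subtype.val (e2.trans (hc w hw).symm)) hne
      · intro w w' hw hw' X Y hXY
        exact ⟨(hc w hw).trans (hc w' hw').symm, hXY⟩
  choose E hE1 hE2 using hE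
  choose F hF using fun c : C => hF c c.2.1 c.2.2
  let J : V → Set V → Set V := fun w X =>
    {x | ∃ hw : p w = v ∧ w ≠ v,
      (ψ ⟨w, hw⟩).symm x ∈ F (rep ⟨w, hw⟩) (E (rep ⟨w, hw⟩) ⟨w, hw⟩ (ψ ⟨w, hw⟩ ⁻¹' X))}
  have hJ : ∀ (w : C) (X : Set V) (x : V),
      ψ w x ∈ J w X ↔ x ∈ F (rep w) (E (rep w) w (ψ w ⁻¹' X)) := fun w X x => by
    constructor
    · rintro ⟨_, hx⟩
      simpa using hx
    · intro hx
      exact ⟨w.2, by simpa using hx⟩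
  refine ⟨J, ?_, ?_⟩
  · intro w hw hwv φ hφ hne X
    have := (hJ ⟨w, hw, hwv⟩ X (rep ⟨w, hw, hwv⟩)).2
      (((hF _).1 _).2 (hE1 _ ⟨w, hw, hwv⟩ rfl ⟨φ, hφ, hne⟩ _))
    rwa [hψ] at this
  · intro w hw hwv φ X Y hφ hXY
    have hφv : φ w ≠ v := fun e => by
      have := h.map_parent_ne φ (w := w) (by rw [hw]; exact hwv.symm)
      rw [hφ] at this
      exact this e.symm
    obtain ⟨a, rfl⟩ : ∃ a : C, (a : V) = w := ⟨⟨w, hw, hwv⟩, rfl⟩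
    obtain ⟨b, hb⟩ : ∃ b : C, (b : V) = φ a := ⟨⟨φ a, hφ, hφv⟩, rfl⟩
    rw [← hb] at hXY ⊢
    have hab : rep b = rep a := (hrep_eq a b φ hb.symm).symm
    -- conjugation turns `φ` into an automorphism fixing the common representative
    let θ : T ≃g T := ((ψ a).trans φ).trans (ψ b).symm
    have hθ : ∀ x, ψ b (θ x) = φ (ψ a x) := fun x => (ψ b).apply_symm_apply _
    have hθc : θ (rep a) = rep a := by
      refine (ψ b).injective ?_
      rw [hθ, hψ, ← hb, ← hab, hψ]
    have hbr : ∀ x, x ∈ branch p (rep a : V) ↔ ψ a x ∈ branch p (a : V) := fun x => by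
      rw [← h.map_mem_branch (ψ a), hψ]
    have key := (hF (rep a)).2 θ (E (rep a) a (ψ a ⁻¹' X))
      (E (rep a) b (ψ b ⁻¹' Y)) hθc fun x hx => by
        have h1 := hXY (ψ a x) ((hbr x).1 hx)
        rw [hJ, ← hθ, hJ, hab] at h1
        exact h1
    obtain ⟨rfl, hagree⟩ := hE2 (rep a) a b rfl hab _ _ fun x hx => (key x hx).1
    refine ⟨rfl, fun x hx => ?_⟩
    have hx' : (ψ a).symm x ∈ branch p (rep a : V) := by
      rw [hbr, RelIso.apply_symm_apply]
      exact hx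
    have h1 := hagree _ hx'
    have h2 := hθ ((ψ a).symm x)
    rw [(key _ hx').2] at h2
    simp only [Set.mem_preimage, RelIso.apply_symm_apply] at h1 h2
    exact ⟨h1, h2.symm⟩

/-- Codes exist for all families of siblings, by induction along the well-founded child
relation. -/
lemma exists_isChildrenCode (h : IsParentMap T p) (hm0 : ℵ₀ ≤ m)
    (hm : ∀ φ : T ≃g T, φ ≠ SimpleGraph.Iso.refl → m ≤ #{v : V | φ v ≠ v})
    (hd : ∀ v, #(T.neighborSet v) ≤ 2 ^ m) (v : V) : ∃ J, IsChildrenCode T p v J := by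
  refine h.exists_isChildrenCode_of_forall_isBranchCode hm0 hm hd fun w _ _ => ?_
  clear * - h hm0 hm hd
  induction w using h.wf.induction with
  | _ w ih =>
    obtain ⟨J, hJ⟩ := h.exists_isChildrenCode_of_forall_isBranchCode hm0 hm hd (v := w)
      fun w' hw' hne => ih w' ⟨hw', hne⟩
    exact h.exists_isBranchCode_of_isChildrenCode hJ

/-- A trunk `R` is a set of vertices closed under `p` that every vertex reaches under `p`. Colour
the trunk by `C` and use the codes for the branches growing out of the trunk. If these colours
force automorphisms to fix `R` pointwise, the outcome is one distinguishing set for each subset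
of `Rᶜ`, and these sets are pairwise inequivalent. -/
lemma exists_code_of_trunk (h : IsParentMap T p) (hm0 : ℵ₀ ≤ m)
    (hm : ∀ φ : T ≃g T, φ ≠ SimpleGraph.Iso.refl → m ≤ #{v : V | φ v ≠ v})
    (hd : ∀ v, #(T.neighborSet v) ≤ 2 ^ m) (R C : Set V)
    (hR : ∀ x ∈ R, p x ∈ R) (hreach : ∀ x, ∃ n, p^[n] x ∈ R)
    (hfix : ∀ (φ : T ≃g T) (S S' : Set V), (∀ x, x ∈ S ↔ φ x ∈ S') →
      (∀ x ∈ R, x ∈ S ↔ x ∈ C) → (∀ x ∈ R, x ∈ S' ↔ x ∈ C) →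
      (∀ w, w ∉ R → p w ∈ R → ∀ ψ : T ≃g T, p (ψ w) = p w → ψ w ≠ w → w ∈ S') →
      ∀ x ∈ R, φ x = x) :
    ∃ F : Set V → Set V, ∀ (φ : T ≃g T) (X Y : Set V), φ '' F X = F Y →
      (∀ x ∉ R, x ∈ X ↔ x ∈ Y) ∧ φ = SimpleGraph.Iso.refl := by
  choose J hJ using h.exists_isChildrenCode hm0 hm hd
  let F : Set V → Set V := fun X =>
    {x | (x ∈ R ∧ x ∈ C) ∨ ∃ w, (w ∉ R ∧ p w ∈ R) ∧ x ∈ branch p w ∧ x ∈ J (p w) w X}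
  have hRn : ∀ n, ∀ x ∈ R, p^[n] x ∈ R := fun n => by
    induction n with
    | zero => exact fun x hx => hx
    | succ n ih => exact fun x hx => ih _ (hR x hx)
  have hnot : ∀ w, w ∉ R → ∀ x ∈ R, x ∉ branch p w := by
    rintro w hw x hx ⟨n, rfl⟩
    exact hw (hRn n x hx)
  have hpw : ∀ w, w ∉ R → p w ∈ R → w ≠ p w := fun w hw hw' e => hw (e ▸ hw')
  have hFR : ∀ X, ∀ x ∈ R, x ∈ F X ↔ x ∈ C := fun X x hx => by
    constructor
    · rintro (hxC | ⟨w, ⟨hw, -⟩, hxw, -⟩)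
      · exact hxC.2
      · exact absurd hxw (hnot w hw x hx)
    · exact fun hxC => .inl ⟨hx, hxC⟩
  have hdisj : ∀ w w', w ∉ R → p w ∈ R → w' ∉ R → w ∈ branch p w' → w = w' := by
    intro w w' _ hw hw' hmem
    by_contra hne
    exact hnot w' hw' _ hw (parent_mem_branch hmem hne)
  have hFJ : ∀ w, w ∉ R → p w ∈ R → ∀ x ∈ branch p w, ∀ X, x ∈ F X ↔ x ∈ J (p w) w X := by
    intro w hw hpwR x hx X
    constructor
    · rintro (⟨hxR, -⟩ | ⟨w', ⟨hw', hpwR'⟩, hx', hxJ⟩)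
      · exact absurd hx (hnot w hw x hxR)
      · have : w = w' := by
          rcases branch_total hx hx' with h1 | h1
          · exact hdisj w w' hw hpwR hw' h1
          · exact (hdisj w' w hw' hpwR' hw h1).symm
        rwa [this]
    · exact fun hxJ => .inr ⟨w, ⟨hw, hpwR⟩, hx, hxJ⟩
  refine ⟨F, fun φ X Y hXY => ?_⟩
  have hmem : ∀ x, x ∈ F X ↔ φ x ∈ F Y := fun x => by
    rw [← hXY, φ.injective.mem_set_image]
  have hφR := hfix φ (F X) (F Y) hmem (hFR X) (hFR Y) fun w hw hpwR ψ hψ hne =>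
    (hFJ w hw hpwR w (self_mem_branch w) Y).2 ((hJ (p w)).1 w rfl (hpw w hw hpwR) ψ hψ hne Y)
  have hmain : ∀ x, x ∉ R → (x ∈ X ↔ x ∈ Y) ∧ φ x = x := by
    intro x hx
    obtain ⟨n, hn⟩ := hreach x
    obtain ⟨w, hw, hpwR, hxw⟩ := exists_mem_branch_of_iterate_mem hn hx
    have hpφ : p (φ w) = p w := by rw [← h.map_parent, hφR _ hpwR]
    have hφw : φ w ∉ R := fun hcon => by
      have := hφR _ hcon
      rw [φ.injective this] at hcon
      exact hw hcon
    refine ((hJ (p w)).2 w rfl (hpw w hw hpwR) φ X Y hpφ fun y hy => ?_).2 x hxw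
    have h1 := hFJ (φ w) hφw (hpφ ▸ hpwR) (φ y) ((h.map_mem_branch φ).2 hy) Y
    rw [hpφ] at h1
    rw [← hFJ w hw hpwR y hy, ← h1]
    exact hmem y
  refine ⟨fun x hx => (hmain x hx).1, RelIso.ext fun x => ?_⟩
  by_cases hx : x ∈ R
  · exact hφR x hx
  · exact (hmain x hx).2

end IsParentMap

/-! ### Walks without backtracking -/

/-- A walk without backtracking in an acyclic graph does not return to its first vertex. -/
lemma ne_of_nonbacktracking (hT : T.IsAcyclic) (f : ℕ → V) (hadj : ∀ n, T.Adj (f n) (f (n + 1)))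
    (hne : ∀ n, f (n + 2) ≠ f n) (n : ℕ) : f (n + 1) ≠ f 0 := by
  have key : ∀ (n : ℕ) (f : ℕ → V), (∀ n, T.Adj (f n) (f (n + 1))) → (∀ n, f (n + 2) ≠ f n) →
      ∃ w : T.Walk (f 0) (f (n + 1)), w.edges.IsChain (· ≠ ·) ∧
        ∃ l, w.edges = s(f 0, f 1) :: l := by
    intro n
    induction n with
    | zero => exact fun f h1 _ => ⟨.cons (h1 0) .nil, by simp, [], by simp⟩
    | succ n ih =>
      intro f h1 h2
      obtain ⟨w, hw, l, hl⟩ := ih (fun k => f (k + 1)) (fun k => h1 (k + 1)) fun k => h2 (k + 1)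
      refine ⟨.cons (h1 0) w, ?_, _, SimpleGraph.Walk.edges_cons _ _⟩
      rw [SimpleGraph.Walk.edges_cons, hl]
      refine List.IsChain.cons_cons ?_ (hl ▸ hw)
      intro e
      rcases Sym2.eq_iff.1 e with ⟨e1, -⟩ | ⟨e1, -⟩
      · exact (h1 0).ne e1
      · exact h2 0 e1.symm
  obtain ⟨w, hw, l, hl⟩ := key n f hadj hne
  have hpath := (hT.isPath_iff_isChain w).2 hw
  intro e
  have hnil : ∀ {a b : V} (q : T.Walk a b), q.IsPath → a = b → q.edges = [] := by
    rintro a b q hq rfl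
    exact SimpleGraph.Walk.edges_eq_nil.2 (SimpleGraph.Walk.isPath_iff_nil.1 hq)
  rw [hnil w hpath e.symm] at hl
  simp at hl

lemma isRay_of_nonbacktracking (hT : T.IsAcyclic) {f : ℕ → V}
    (hadj : ∀ n, T.Adj (f n) (f (n + 1))) (hne : ∀ n, f (n + 2) ≠ f n) : IsRay T f := by
  refine ⟨fun i j hij => ?_, hadj⟩
  by_contra hcon
  wlog hlt : i < j generalizing i j
  · exact this j i hij.symm (Ne.symm hcon) (lt_of_le_of_ne (not_lt.1 hlt) (Ne.symm hcon))
  obtain ⟨k, rfl⟩ := Nat.exists_eq_add_of_lt hlt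
  exact ne_of_nonbacktracking hT (fun n => f (i + n)) (fun n => hadj (i + n))
    (fun n => hne (i + n)) k hij.symm

lemma isDoubleRay_of_nonbacktracking (hT : T.IsAcyclic) {f : ℤ → V}
    (hadj : ∀ n, T.Adj (f n) (f (n + 1))) (hne : ∀ n, f (n + 2) ≠ f n) : IsDoubleRay T f := by
  refine ⟨fun i j hij => ?_, hadj⟩
  by_contra hcon
  wlog hlt : i < j generalizing i j
  · exact this j i hij.symm (Ne.symm hcon) (lt_of_le_of_ne (not_lt.1 hlt) (Ne.symm hcon))
  obtain ⟨k, hk⟩ := Int.le.dest (Int.add_one_le_of_lt hlt)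
  refine ne_of_nonbacktracking hT (fun n => f (i + n)) (fun n => ?_) (fun n => ?_) k ?_
  · have := hadj (i + n)
    push_cast
    rwa [← add_assoc]
  · have := hne (i + n)
    push_cast
    rwa [← add_assoc]
  · simp only [Nat.cast_add, Nat.cast_one, Nat.cast_zero, add_zero]
    rw [hij, ← hk]
    congr 1
    ring

/-! ### Rayless trees: the parent is one step closer to the centre -/

/-- The pair `(v, some u)` stands for the part of the tree that is seen from `v` when looking away
from its neighbour `u`, and `(v, none)` for the whole tree seen from `v`. A part lies below another
one if it is seen after one step into it. -/
def PartRel (T : SimpleGraph V) (a b : V × Option V) : Prop :=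
  T.Adj b.1 a.1 ∧ a.2 = some b.1 ∧ b.2 ≠ some a.1

lemma isWellFounded_partRel (hT : T.IsAcyclic) (hray : Rayless T) :
    IsWellFounded _ (PartRel T) := by
  refine ⟨wellFounded_iff_isEmpty_descending_chain.2 ⟨fun ⟨f, hf⟩ => hray ?_⟩⟩
  refine ⟨fun n => (f n).1, isRay_of_nonbacktracking hT (fun n => (hf n).1) fun n e => ?_⟩
  have h1 := (hf (n + 1)).2.2
  rw [(hf n).2.1, e] at h1
  exact h1 rfl

section Eccentricity

variable [hwf : IsWellFounded _ (PartRel T)]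

/-- A transfinite eccentricity: the ordinal rank of the tree seen from `v`. -/
noncomputable def eccentricity (T : SimpleGraph V) [IsWellFounded _ (PartRel T)] (v : V) :
    Ordinal.{u} :=
  IsWellFounded.rank (PartRel T) (v, none)

lemma rank_partRel_map_le (φ : T ≃g T) (a : V × Option V) :
    IsWellFounded.rank (PartRel T) (φ a.1, a.2.map φ) ≤ IsWellFounded.rank (PartRel T) a := by
  induction a using hwf.wf.induction with
  | _ a ih =>
    rw [IsWellFounded.rank_eq]
    refine Ordinal.iSup_le ?_
    rintro ⟨⟨w, o⟩, h1, h2, h3⟩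
    obtain ⟨w, rfl⟩ := φ.surjective w
    simp only at h1 h2 h3
    subst h2
    have hrel : PartRel T (w, some a.1) a := by
      refine ⟨φ.map_rel_iff.1 h1, rfl, fun e => h3 ?_⟩
      rw [e]
      rfl
    exact Order.succ_le_of_lt ((ih _ hrel).trans_lt (IsWellFounded.rank_lt_of_rel hrel))

lemma eccentricity_map (φ : T ≃g T) (v : V) : eccentricity T (φ v) = eccentricity T v := by
  refine le_antisymm (rank_partRel_map_le φ (v, none)) ?_
  have := rank_partRel_map_le φ.symm (φ v, none)
  rwa [RelIso.symm_apply_apply] at this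

/-- The eccentricity is strictly quasiconvex along paths: a part seen from `v` is, up to one step,
also seen from one of the two neighbours `u` and `w`. -/
lemma eccentricity_lt_max {u v w : V} (hu : T.Adj v u) (hw : T.Adj v w) (hne : u ≠ w) :
    eccentricity T v < max (eccentricity T u) (eccentricity T w) := by
  have hlt : ∀ z, T.Adj v z →
      IsWellFounded.rank (PartRel T) (v, some z) < eccentricity T z := fun z hz =>
    IsWellFounded.rank_lt_of_rel ⟨hz.symm, rfl, by simp⟩
  have hle : eccentricity T v ≤ max (IsWellFounded.rank (PartRel T) (v, some u))
      (IsWellFounded.rank (PartRel T) (v, some w)) := by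
    rw [eccentricity, IsWellFounded.rank_eq]
    refine Ordinal.iSup_le ?_
    rintro ⟨⟨x, o⟩, h1, h2, h3⟩
    simp only at h1 h2
    subst h2
    refine Order.succ_le_of_lt ?_
    by_cases hxu : x = u
    · exact lt_max_of_lt_right (IsWellFounded.rank_lt_of_rel
        ⟨h1, rfl, fun e => hne (hxu.symm.trans (Option.some.inj e).symm)⟩)
    · exact lt_max_of_lt_left (IsWellFounded.rank_lt_of_rel
        ⟨h1, rfl, fun e => hxu (Option.some.inj e).symm⟩)
  exact hle.trans_lt (max_lt_max (hlt u hu) (hlt w hw))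

lemma eq_of_adj_of_eccentricity_le {u v w : V} (hu : T.Adj v u) (hw : T.Adj v w)
    (hue : eccentricity T u ≤ eccentricity T v) (hwe : eccentricity T w ≤ eccentricity T v) :
    u = w := by
  by_contra hne
  exact absurd (eccentricity_lt_max hu hw hne) (not_lt.2 (max_le hue hwe))

open Classical in
/-- The neighbour of smaller eccentricity, if there is one, and `v` itself otherwise. -/
noncomputable def centralNeighbor (T : SimpleGraph V) [IsWellFounded _ (PartRel T)] (v : V) : V :=
  if h : ∃ u, T.Adj v u ∧ eccentricity T u < eccentricity T v then h.choose else v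

lemma centralNeighbor_eq {u v : V} (hu : T.Adj v u) (hlt : eccentricity T u < eccentricity T v) :
    centralNeighbor T v = u := by
  have h : ∃ u, T.Adj v u ∧ eccentricity T u < eccentricity T v := ⟨u, hu, hlt⟩
  rw [centralNeighbor, dif_pos h]
  exact eq_of_adj_of_eccentricity_le h.choose_spec.1 hu h.choose_spec.2.le hlt.le

lemma centralNeighbor_spec {v : V} (hv : centralNeighbor T v ≠ v) :
    T.Adj v (centralNeighbor T v) ∧ eccentricity T (centralNeighbor T v) < eccentricity T v := by
  by_cases h : ∃ u, T.Adj v u ∧ eccentricity T u < eccentricity T v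
  · obtain ⟨u, hu, hlt⟩ := h
    rw [centralNeighbor_eq hu hlt]
    exact ⟨hu, hlt⟩
  · exact absurd (dif_neg h) hv

lemma le_eccentricity_of_adj {u v : V} (hv : centralNeighbor T v = v) (hu : T.Adj v u) :
    eccentricity T v ≤ eccentricity T u := by
  by_contra! hlt
  exact hu.ne ((centralNeighbor_eq hu hlt).symm.trans hv).symm

lemma isParentMap_centralNeighbor (hray : Rayless T) : IsParentMap T (centralNeighbor T) where
  adj_parent v hv := (centralNeighbor_spec hv).1
  of_adj u v huv := by
    rcases lt_trichotomy (eccentricity T u) (eccentricity T v) with h | h | h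
    · exact .inr (.inl (centralNeighbor_eq huv.symm h))
    · refine .inr (.inr ⟨?_, ?_⟩) <;> by_contra hne <;>
        obtain ⟨h1, h2⟩ := centralNeighbor_spec hne
      · exact h2.ne ((eq_of_adj_of_eccentricity_le h1 huv h2.le h.ge) ▸ h.symm)
      · exact h2.ne ((eq_of_adj_of_eccentricity_le h1 huv.symm h2.le h.le) ▸ h)
    · exact .inl (centralNeighbor_eq huv h)
  map_parent φ v := by
    by_cases h : ∃ u, T.Adj v u ∧ eccentricity T u < eccentricity T v
    · obtain ⟨u, hu, hlt⟩ := h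
      rw [centralNeighbor_eq hu hlt, centralNeighbor_eq (φ.map_rel_iff.2 hu)]
      rwa [eccentricity_map, eccentricity_map]
    · have hφ : ¬ ∃ u, T.Adj (φ v) u ∧ eccentricity T u < eccentricity T (φ v) := by
        rintro ⟨u, hu, hlt⟩
        obtain ⟨u, rfl⟩ := φ.surjective u
        rw [eccentricity_map, eccentricity_map] at hlt
        exact h ⟨u, φ.map_rel_iff.1 hu, hlt⟩
      rw [centralNeighbor, centralNeighbor, dif_neg h, dif_neg hφ]
  wf := by
    refine wellFounded_iff_isEmpty_descending_chain.2 ⟨fun ⟨f, hf⟩ => hray ⟨f, ?_, fun n => ?_⟩⟩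
    · refine Function.Injective.of_comp (f := eccentricity T)
        (strictMono_nat_of_lt_succ ?_).injective
      intro n
      obtain ⟨h1, h2⟩ := hf n
      simp only [Function.comp_apply]
      rw [← h1] at h2 ⊢
      exact (centralNeighbor_spec h2.symm).2
    · obtain ⟨h1, h2⟩ := hf n
      rw [← h1] at h2 ⊢
      exact (centralNeighbor_spec h2.symm).1.symm

lemma exists_iterate_centralNeighbor_fixed (v : V) :
    ∃ n, centralNeighbor T ((centralNeighbor T)^[n] v) = (centralNeighbor T)^[n] v := by
  induction h : eccentricity T v using WellFoundedLT.induction generalizing v with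
  | ind o ih =>
    by_cases hv : centralNeighbor T v = v
    · exact ⟨0, hv⟩
    · obtain ⟨n, hn⟩ := ih _ (h ▸ (centralNeighbor_spec hv).2) _ rfl
      exact ⟨n + 1, hn⟩

/-- The centre is a vertex or an edge: two fixed points of `centralNeighbor` are equal or
adjacent. -/
lemma eq_or_adj_of_centralNeighbor_eq (hconn : T.Connected) (hray : Rayless T) {s t : V}
    (hs : centralNeighbor T s = s) (ht : centralNeighbor T t = t) : s = t ∨ T.Adj s t := by
  -- the vertices from which iteration leads to `s` or to a root adjacent to `s` are closed
  -- under adjacency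
  have key : ∀ x, T.Reachable s x → ∃ n r, (centralNeighbor T)^[n] x = r ∧
      centralNeighbor T r = r ∧ (s = r ∨ T.Adj s r) := by
    intro x hx
    rw [SimpleGraph.reachable_iff_reflTransGen] at hx
    induction hx with
    | refl => exact ⟨0, s, rfl, hs, .inl rfl⟩
    | @tail x y _ hxy ih =>
      obtain ⟨n, r, hn, hr, hsr⟩ := ih
      rcases (isParentMap_centralNeighbor hray).of_adj x y hxy with e | e | ⟨ex, ey⟩
      · cases n with
        | zero =>
          rw [Function.iterate_zero, id] at hn
          subst hn
          exact absurd (hr.symm.trans e) hxy.ne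
        | succ n => exact ⟨n, r, by rw [← e]; exact hn, hr, hsr⟩
      · exact ⟨n + 1, r, by rw [Function.iterate_succ_apply, e, hn], hr, hsr⟩
      · rw [Function.iterate_fixed ex] at hn
        subst hn
        refine ⟨0, y, rfl, ey, ?_⟩
        rcases hsr with rfl | hsx
        · exact .inr hxy
        · exact .inl (eq_of_adj_of_eccentricity_le hsx.symm hxy
            (le_eccentricity_of_adj hs hsx) (le_eccentricity_of_adj ey hxy.symm))
  obtain ⟨n, r, hn, -, h⟩ := key t (hconn s t)
  rw [Function.iterate_fixed ht] at hn
  rwa [hn]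

lemma eq_of_centralNeighbor_eq (hconn : T.Connected) (hray : Rayless T) {r s t : V}
    (hr : centralNeighbor T r = r) (hs : centralNeighbor T s = s) (ht : centralNeighbor T t = t)
    (hsr : s ≠ r) (htr : t ≠ r) : s = t := by
  have h1 := (eq_or_adj_of_centralNeighbor_eq hconn hray hr hs).resolve_left hsr.symm
  have h2 := (eq_or_adj_of_centralNeighbor_eq hconn hray hr ht).resolve_left htr.symm
  exact eq_of_adj_of_eccentricity_le h1 h2 (le_eccentricity_of_adj hs h1.symm)
    (le_eccentricity_of_adj ht h2.symm)

end Eccentricity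

/-! ### One-ended trees: the parent is the next vertex towards the end -/

namespace IsRay

lemma tail {r : ℕ → V} (hr : IsRay T r) : IsRay T fun n => r (n + 1) :=
  ⟨fun i j hij => by simpa using hr.1 hij, fun n => hr.2 (n + 1)⟩

lemma map {r : ℕ → V} (hr : IsRay T r) (φ : T ≃g T) : IsRay T fun n => φ (r n) :=
  ⟨fun _ _ hij => hr.1 (φ.injective hij), fun n => φ.map_rel_iff.2 (hr.2 n)⟩

lemma cons (hT : T.IsAcyclic) {r : ℕ → V} (hr : IsRay T r) {y : V} (hy : T.Adj y (r 0))
    (hne : r 1 ≠ y) : IsRay T fun n => Nat.casesOn n y r := by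
  refine isRay_of_nonbacktracking hT ?_ ?_
  · rintro (_ | n)
    · exact hy
    · exact hr.2 n
  · rintro (_ | n)
    · exact hne
    · intro e
      have := hr.1 e
      omega

/-- Two rays from the same vertex with different first steps form a double ray. -/
lemma apply_one_eq (hT : T.IsAcyclic) (hdbl : ¬ ∃ r : ℤ → V, IsDoubleRay T r) {r r' : ℕ → V}
    (hr : IsRay T r) (hr' : IsRay T r') (h0 : r 0 = r' 0) : r 1 = r' 1 := by
  by_contra hne
  refine hdbl ⟨fun | .ofNat n => r n | .negSucc n => r' (n + 1),
    isDoubleRay_of_nonbacktracking hT ?_ ?_⟩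
  · rintro (n | _ | n)
    · exact hr.2 n
    · change T.Adj (r' 1) (r 0)
      rw [h0]
      exact (hr'.2 0).symm
    · exact (hr'.2 (n + 1)).symm
  · rintro (n | _ | _ | n)
    · intro e
      have : n + 2 = n := hr.1 e
      omega
    · exact hne
    · change r 0 ≠ r' 2
      rw [h0]
      intro e
      have := hr'.1 e
      omega
    · intro e
      have : n + 1 = n + 1 + 1 + 1 := hr'.1 e
      omega

end IsRay

lemma exists_isRay_from (hT : T.IsTree) (hr : ∃ r : ℕ → V, IsRay T r) (v : V) :
    ∃ r : ℕ → V, IsRay T r ∧ r 0 = v := by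
  obtain ⟨r, hr⟩ := hr
  have h := hT.connected (r 0) v
  rw [SimpleGraph.reachable_iff_reflTransGen] at h
  induction h with
  | refl => exact ⟨r, hr, rfl⟩
  | @tail x y _ hxy ih =>
    obtain ⟨s, hs, rfl⟩ := ih
    by_cases h1 : s 1 = y
    · exact ⟨_, hs.tail, h1⟩
    · exact ⟨_, hs.cons hT.isAcyclic hxy.symm h1, rfl⟩

open Classical in
/-- The second vertex of a ray starting at `v`, if there is one, and `v` itself otherwise. -/
noncomputable def towardsEnd (T : SimpleGraph V) (v : V) : V :=
  if h : ∃ r : ℕ → V, IsRay T r ∧ r 0 = v then h.choose 1 else v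

lemma IsRay.towardsEnd_eq (hT : T.IsTree) (hone : OneEnded T) {r : ℕ → V}
    (hr : IsRay T r) : towardsEnd T (r 0) = r 1 := by
  have h : ∃ s : ℕ → V, IsRay T s ∧ s 0 = r 0 := ⟨r, hr, rfl⟩
  rw [towardsEnd, dif_pos h]
  exact IsRay.apply_one_eq hT.isAcyclic hone.2 h.choose_spec.1 hr h.choose_spec.2

lemma adj_towardsEnd (hT : T.IsTree) (hone : OneEnded T) (v : V) : T.Adj v (towardsEnd T v) := by
  obtain ⟨r, hr, rfl⟩ := exists_isRay_from hT hone.1 v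
  rw [hr.towardsEnd_eq hT hone]
  exact hr.2 0

lemma towardsEnd_towardsEnd_ne (hT : T.IsTree) (hone : OneEnded T) (v : V) :
    towardsEnd T (towardsEnd T v) ≠ v := by
  obtain ⟨r, hr, rfl⟩ := exists_isRay_from hT hone.1 v
  rw [hr.towardsEnd_eq hT hone, hr.tail.towardsEnd_eq hT hone]
  intro e
  have := hr.1 e
  omega

lemma isParentMap_towardsEnd (hT : T.IsTree) (hone : OneEnded T) :
    IsParentMap T (towardsEnd T) where
  adj_parent v _ := adj_towardsEnd hT hone v
  of_adj u v huv := by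
    obtain ⟨r, hr, rfl⟩ := exists_isRay_from hT hone.1 u
    by_cases h1 : r 1 = v
    · exact .inl (by rw [hr.towardsEnd_eq hT hone, h1])
    · exact .inr (.inl ((hr.cons hT.isAcyclic huv.symm h1).towardsEnd_eq hT hone))
  map_parent φ v := by
    obtain ⟨r, hr, rfl⟩ := exists_isRay_from hT hone.1 v
    rw [hr.towardsEnd_eq hT hone, (hr.map φ).towardsEnd_eq hT hone]
  wf := by
    refine wellFounded_iff_isEmpty_descending_chain.2 ⟨fun ⟨f, hf⟩ => hone.2 ?_⟩
    let g : ℤ → V := fun | .ofNat n => (towardsEnd T)^[n] (f 0) | .negSucc n => f (n + 1)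
    have hg : ∀ n, g (n + 1) = towardsEnd T (g n) := by
      rintro (n | _ | n)
      · exact Function.iterate_succ_apply' _ n _
      · exact (hf 0).1.symm
      · exact (hf (n + 1)).1.symm
    refine ⟨g, isDoubleRay_of_nonbacktracking hT.isAcyclic (fun n => ?_) fun n => ?_⟩
    · rw [hg]
      exact adj_towardsEnd hT hone _
    · rw [show n + 2 = n + 1 + 1 by ring, hg, hg]
      exact towardsEnd_towardsEnd_ne hT hone _

/-! ### Automorphisms of graphs with a parent map without roots -/

namespace IsParentMap

/-- Without roots, any two vertices of a connected graph have a common ancestor. -/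
lemma exists_iterate_eq_iterate (h : IsParentMap T p) (hconn : T.Connected) (hp : ∀ v, p v ≠ v)
    (x y : V) : ∃ a b, p^[a] x = p^[b] y := by
  have hxy := hconn x y
  rw [SimpleGraph.reachable_iff_reflTransGen] at hxy
  induction hxy with
  | refl => exact ⟨0, 0, rfl⟩
  | @tail y z _ hyz ih =>
    obtain ⟨a, b, hab⟩ := ih
    rcases h.of_adj y z hyz with e | e | ⟨e, -⟩
    · refine ⟨a + 1, b, ?_⟩
      rw [Function.iterate_succ_apply', hab, ← e]
      exact (Function.iterate_succ_apply' p b y).symm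
    · exact ⟨a, b + 1, by rw [hab, ← e]; rfl⟩
    · exact absurd e (hp y)

/-- No automorphism moves a vertex to one of its proper ancestors: otherwise it would do the same
to some child of that vertex, against well-foundedness. -/
lemma map_ne_iterate (h : IsParentMap T p) (hp : ∀ v, p v ≠ v) (φ : T ≃g T) (k : ℕ) (y : V) :
    φ y ≠ p^[k + 1] y := by
  induction y using h.wf.induction with
  | _ y ih =>
    intro hy
    have hz : p (p^[k] (φ.symm y)) = y := by
      refine (Function.iterate_succ_apply' p k _).symm.trans ?_
      rw [← h.map_iterate, ← hy, RelIso.symm_apply_apply]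
    refine ih _ ⟨hz, fun e => hp _ (hz.trans e.symm)⟩ ?_
    rw [h.map_iterate, RelIso.apply_symm_apply, Function.iterate_succ_apply, hz]

/-- Without roots, an automorphism fixes all sufficiently high ancestors of a vertex. -/
lemma exists_map_iterate_eq (h : IsParentMap T p) (hconn : T.Connected) (hp : ∀ v, p v ≠ v)
    (φ : T ≃g T) (x : V) : ∃ n, φ (p^[n] x) = p^[n] x := by
  obtain ⟨a, b, hab⟩ := h.exists_iterate_eq_iterate hconn hp x (φ x)
  rw [← h.map_iterate] at hab
  rcases lt_trichotomy a b with hlt | rfl | hlt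
  · obtain ⟨k, rfl⟩ := Nat.exists_eq_add_of_lt hlt
    refine absurd ?_ (h.map_ne_iterate hp φ.symm k (p^[a] x))
    rw [← Function.iterate_add_apply, hab, RelIso.symm_apply_apply,
      show k + 1 + a = a + k + 1 by omega]
  · exact ⟨a, hab.symm⟩
  · obtain ⟨k, rfl⟩ := Nat.exists_eq_add_of_lt hlt
    refine absurd ?_ (h.map_ne_iterate hp φ k (p^[b] x))
    rw [← hab, ← Function.iterate_add_apply, show k + 1 + b = b + k + 1 by omega]

lemma iterate_injective (h : IsParentMap T p) (hp : ∀ v, p v ≠ v) (x : V) :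
    Function.Injective fun n => p^[n] x := by
  intro i j hij
  by_contra hcon
  wlog hlt : i < j generalizing i j
  · exact this hij.symm (Ne.symm hcon) (lt_of_le_of_ne (not_lt.1 hlt) (Ne.symm hcon))
  obtain ⟨k, rfl⟩ := Nat.exists_eq_add_of_lt hlt
  refine hp _ (h.eq_of_iterate_eq k (p^[i] x) ?_)
  rw [← Function.iterate_add_apply, show k + 1 + i = i + k + 1 by omega]
  exact hij.symm

end IsParentMap

/-! ### Counting inequivalent distinguishing sets -/

lemma asymNumber_le (T : SimpleGraph V) : asymNumber T ≤ 2 ^ #V := by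
  rw [← mk_set]
  exact mk_quotient_le.trans (mk_subtype_le _)

/-- Inequivalent distinguishing sets indexed by the subsets of a full-sized set give the lower
bound. -/
lemma le_asymNumber_of_code {R : Set V} (hR : #(Rᶜ : Set V) = #V)
    (hF : ∃ F : Set V → Set V, ∀ (φ : T ≃g T) (X Y : Set V), φ '' F X = F Y →
      (∀ x ∉ R, x ∈ X ↔ x ∈ Y) ∧ φ = SimpleGraph.Iso.refl) : 2 ^ #V ≤ asymNumber T := by
  obtain ⟨F, hF⟩ := hF
  rw [← hR, ← mk_set]
  refine mk_le_of_injective (f := fun X : Set (Rᶜ : Set V) => Quotient.mk (distinguishingSetoid T)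
    ⟨F (Subtype.val '' X), fun φ hφ => (hF φ _ _ hφ).2⟩) fun X Y hXY => ?_
  obtain ⟨φ, hφ⟩ := Quotient.exact hXY
  ext x
  have hx : (x : V) ∉ R := x.2
  simpa [hx] using (hF φ _ _ hφ).1 x hx

lemma mk_compl_eq_of_le {R : Set V} (h1 : ℵ₀ ≤ #(Rᶜ : Set V)) (h2 : #R ≤ #(Rᶜ : Set V)) :
    #(Rᶜ : Set V) = #V := by
  rw [← mk_sum_compl R, add_eq_right h1 h2]

/-- In a rayless tree the centre serves as trunk. It is finite, so nothing is lost by not using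
the subsets of the trunk in the count. -/
lemma exists_code_of_rayless (hT : T.IsTree) (hray : Rayless T) (hm0 : ℵ₀ ≤ m)
    (hm : ∀ φ : T ≃g T, φ ≠ SimpleGraph.Iso.refl → m ≤ #{v : V | φ v ≠ v})
    (hd : ∀ v, #(T.neighborSet v) ≤ 2 ^ m) (hV : ℵ₀ ≤ #V) :
    ∃ R : Set V, #(Rᶜ : Set V) = #V ∧ ∃ F : Set V → Set V, ∀ (φ : T ≃g T) (X Y : Set V),
      φ '' F X = F Y → (∀ x ∉ R, x ∈ X ↔ x ∈ Y) ∧ φ = SimpleGraph.Iso.refl := by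
  have := isWellFounded_partRel hT.isAcyclic hray
  have h := isParentMap_centralNeighbor hray
  obtain ⟨v⟩ := hT.connected.nonempty
  obtain ⟨n, hn⟩ := exists_iterate_centralNeighbor_fixed (T := T) v
  generalize (centralNeighbor T)^[n] v = r at hn
  -- the trunk is the centre; the colour tells `r` from the other root, if there is one
  let R : Set V := {x | centralNeighbor T x = x}
  have hRfin : R.Finite := by
    have hsub : (R \ {r}).Subsingleton := fun s hs t ht =>
      eq_of_centralNeighbor_eq hT.connected hray hn hs.1 ht.1 hs.2 ht.2
    exact (hsub.finite.union (Set.finite_singleton r)).subset fun x hx => by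
      by_cases hxr : x = r
      · exact .inr hxr
      · exact .inl ⟨hx, hxr⟩
  have hVinf : Infinite V := infinite_iff.2 hV
  refine ⟨R, mk_compl_of_infinite R (hRfin.lt_aleph0.trans_le hV),
    h.exists_code_of_trunk hm0 hm hd R {r} ?_ exists_iterate_centralNeighbor_fixed ?_⟩
  · intro x hx
    exact congrArg (centralNeighbor T) hx
  · intro φ S S' hSS hS hS' _ x hx
    have hφR : ∀ y ∈ R, φ y ∈ R := fun y hy => (h.map_parent φ y).symm.trans (congrArg φ hy)
    have hφr : φ r = r := (hS' _ (hφR r hn)).1 ((hSS r).1 ((hS r hn).2 rfl))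
    by_cases hxr : x = r
    · rw [hxr, hφr]
    · exact eq_of_centralNeighbor_eq hT.connected hray hn (hφR x hx) hx
        (fun e => hxr (φ.injective (e.trans hφr.symm))) hxr

/-- Without roots, a moved vertex has an ancestor that is moved to one of its siblings, so some
branch is at least as large as the motion. -/
lemma IsParentMap.exists_le_mk_branch (h : IsParentMap T p) (hconn : T.Connected)
    (hp : ∀ v, p v ≠ v) (hm0 : ℵ₀ ≤ m)
    (hm : ∀ φ : T ≃g T, φ ≠ SimpleGraph.Iso.refl → m ≤ #{v : V | φ v ≠ v})
    {φ : T ≃g T} {x : V} (hx : φ x ≠ x) : ∃ v, m ≤ #(branch p v) := by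
  obtain ⟨n, hn⟩ := h.exists_map_iterate_eq hconn hp φ x
  obtain ⟨w, hw, hpw, -⟩ := exists_mem_branch_of_iterate_mem (R := {y | φ y = y}) hn hx
  exact ⟨w, h.le_mk_branch hm0 hm φ (hp w) ((h.map_parent φ w).symm.trans hpw) hw⟩

/-- In a one-ended tree the trunk is a ray that starts at a vertex with an infinite branch. That
branch lies outside the trunk except for its top, which makes the complement of the trunk large
enough. -/
lemma exists_code_of_oneEnded (hT : T.IsTree) (hone : OneEnded T) (hm0 : ℵ₀ ≤ m)
    (hm : ∀ φ : T ≃g T, φ ≠ SimpleGraph.Iso.refl → m ≤ #{v : V | φ v ≠ v})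
    (hd : ∀ v, #(T.neighborSet v) ≤ 2 ^ m) {φ₀ : T ≃g T} {x₀ : V} (hx₀ : φ₀ x₀ ≠ x₀) :
    ∃ R : Set V, #(Rᶜ : Set V) = #V ∧ ∃ F : Set V → Set V, ∀ (φ : T ≃g T) (X Y : Set V),
      φ '' F X = F Y → (∀ x ∉ R, x ∈ X ↔ x ∈ Y) ∧ φ = SimpleGraph.Iso.refl := by
  have h := isParentMap_towardsEnd hT hone
  have hp : ∀ v, towardsEnd T v ≠ v := fun v => (adj_towardsEnd hT hone v).ne'
  generalize towardsEnd T = p at h hp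
  obtain ⟨v, hv⟩ := h.exists_le_mk_branch hT.connected hp hm0 hm hx₀
  -- the trunk is the ray from `v`, and it is disjoint from the distinguishing sets
  let R : Set V := Set.range fun n => p^[n] v
  have hinf : ℵ₀ ≤ #(Rᶜ : Set V) := by
    have : (branch p v).Infinite := by
      rw [← Set.infinite_coe_iff, infinite_iff]
      exact hm0.trans hv
    have hdiff := this.sdiff (Set.finite_singleton v)
    rw [← Set.infinite_coe_iff, infinite_iff] at hdiff
    refine hdiff.trans (mk_le_mk_of_subset ?_)
    rintro _ ⟨hx, hxv⟩ ⟨n, rfl⟩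
    exact hxv (h.branch_antisymm hx ⟨n, rfl⟩)
  refine ⟨R, mk_compl_eq_of_le hinf ((Set.countable_range _).le_aleph0.trans hinf),
    h.exists_code_of_trunk hm0 hm hd R ∅ ?_ ?_ ?_⟩
  · rintro _ ⟨n, rfl⟩
    exact ⟨n + 1, Function.iterate_succ_apply' p n v⟩
  · intro x
    obtain ⟨a, b, hab⟩ := h.exists_iterate_eq_iterate hT.connected hp x v
    exact ⟨a, b, hab.symm⟩
  · intro φ S S' hSS hS hS' hcol
    have hdown : ∀ n, φ (p^[n + 1] v) = p^[n + 1] v → φ (p^[n] v) = p^[n] v := by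
      intro n hn
      by_contra hne
      have hpn : p (φ (p^[n] v)) = p^[n + 1] v := by
        rw [← h.map_parent, ← Function.iterate_succ_apply' p, hn]
      -- `φ (p^[n] v)` has an isomorphic sibling on the trunk, so it is coloured, unlike the trunk
      have hmem : φ (p^[n] v) ∈ S' := by
        refine hcol _ ?_ ⟨n + 1, hpn.symm⟩ φ.symm ?_ ?_
        · rintro ⟨k, hk⟩
          have hk' : p^[k] v = φ (p^[n] v) := hk
          rw [← hk', ← Function.iterate_succ_apply' p] at hpn
          have := h.iterate_injective hp v hpn
          rw [Nat.succ_injective this] at hk'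
          exact hne hk'.symm
        · rw [RelIso.symm_apply_apply, hpn]
          exact (Function.iterate_succ_apply' p n v).symm
        · rw [RelIso.symm_apply_apply]
          exact Ne.symm hne
      exact (hS _ ⟨n, rfl⟩).1 ((hSS _).2 hmem)
    obtain ⟨N, hN⟩ := h.exists_map_iterate_eq hT.connected hp φ v
    rintro _ ⟨n, rfl⟩
    rcases le_total N n with hle | hle
    · obtain ⟨k, rfl⟩ := Nat.exists_eq_add_of_le' hle
      simp only
      rw [Function.iterate_add_apply, h.map_iterate, hN]
    · exact Nat.decreasingInduction' (fun k _ _ hk => hdown k hk) hle hN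

end TreeAsym

theorem theorem4p2 {V : Type u} (T : SimpleGraph V) (hT : T.IsTree)
    (hray : TreeAsym.Rayless T ∨ TreeAsym.OneEnded T)
    (hinf : (Cardinal.aleph0 : WithTop Cardinal.{u}) ≤ TreeAsym.motion T)
    (hdeg : ∀ m : Cardinal.{u}, TreeAsym.motion T = m → TreeAsym.maxDegree T ≤ 2 ^ m) :
    TreeAsym.asymNumber T = 2 ^ Cardinal.mk V := by
  refine le_antisymm (TreeAsym.asymNumber_le T) ?_
  by_cases hasym : ∀ φ : T ≃g T, φ = SimpleGraph.Iso.refl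
  · -- all sets are distinguishing and no two are equivalent
    refine TreeAsym.le_asymNumber_of_code (R := ∅) (by simp) ⟨id, fun φ X Y hXY => ?_⟩
    obtain rfl := hasym φ
    exact ⟨fun x _ => by simp [← show _ = Y from hXY], rfl⟩
  push Not at hasym
  obtain ⟨φ₀, hφ₀⟩ := hasym
  have hle : ∀ φ : T ≃g T, φ ≠ SimpleGraph.Iso.refl →
      TreeAsym.motion T ≤ ((Cardinal.mk {v : V | φ v ≠ v} : Cardinal.{u}) : WithTop Cardinal.{u}) :=
    fun φ hφ => iInf_le (fun φ : {φ : T ≃g T // φ ≠ SimpleGraph.Iso.refl} =>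
      ((Cardinal.mk {v : V | φ.1 v ≠ v} : Cardinal.{u}) : WithTop Cardinal.{u})) ⟨φ, hφ⟩
  obtain ⟨m, hmot⟩ := WithTop.ne_top_iff_exists.1
    (ne_top_of_le_ne_top WithTop.coe_ne_top (hle φ₀ hφ₀))
  have hm : ∀ φ : T ≃g T, φ ≠ SimpleGraph.Iso.refl → m ≤ Cardinal.mk {v : V | φ v ≠ v} :=
    fun φ hφ => WithTop.coe_le_coe.1 (hmot ▸ hle φ hφ)
  have hm0 : Cardinal.aleph0 ≤ m := by
    rw [← hmot] at hinf
    exact WithTop.coe_le_coe.1 hinf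
  have hd : ∀ v, Cardinal.mk (T.neighborSet v) ≤ 2 ^ m := fun v =>
    (le_ciSup (f := fun v : V => Cardinal.mk (T.neighborSet v)) Cardinal.bddAbove_of_small v).trans
      (hdeg m hmot.symm)
  rcases hray with hray | hone
  · obtain ⟨R, hR, hF⟩ := TreeAsym.exists_code_of_rayless hT hray hm0 hm hd
      (hm0.trans ((hm φ₀ hφ₀).trans (Cardinal.mk_set_le _)))
    exact TreeAsym.le_asymNumber_of_code hR hF
  · obtain ⟨x₀, hx₀⟩ : ∃ x, φ₀ x ≠ x := by
      by_contra! hall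
      exact hφ₀ (RelIso.ext hall)
    obtain ⟨R, hR, hF⟩ := TreeAsym.exists_code_of_oneEnded hT hone hm0 hm hd hx₀
    exact TreeAsym.le_asymNumber_of_code hR hF
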